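/- Let $n \ge 2$. Let $$\mathbb{L}^n = \{x \in \mathbb{R}^n \mid x_1 \ge \sqrt{x_2^2 + \cdots + x_n^2}\}$$ be the second-order cone, and let $$\mathcal{CP}(\mathbb{L}^n) = \Big\{ \sum_{i=1}^k a_i a_i^\top \;\Big|\; k \ge 1,\ a_1, \dots, a_k \in \mathbb{L}^n \Big\}$$ be the completely positive cone over $\mathbb{L}^n$, in the space $\mathbb{S}^n$ of real symmetric $n \times n$ matrices. A face of a convex cone $\mathbb{K}$ is a nonempty convex subcone $\mathbb{F} \subseteq \mathbb{K}$ such that $a, b \in \mathbb{K}$ and $a + b \in \mathbb{F}$ imply $a, b \in \mathbb{F}$. The distance to polyhedrality $\ell_{\rm poly}(\mathbb{K})$ of $\mathbb{K}$ is the maximum length $l$ of a chain $\mathbb{F}_l \subsetneq \cdots \subsetneq \mathbb{F}_1$ of faces of $\mathbb{K}$ such that $\mathbb{F}_l$ is not polyhedral, where a convex cone is polyhedral if it is the intersection of finitely many closed half-spaces $\{x \mid f(x) \ge 0\}$ with $f$ a linear functional. Then the distance to polyhedrality of $\mathcal{CP}(\mathbb{L}^n)$ exists (the maximum is attained) and $$\ell_{\rm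 poly}(\mathcal{CP}(\mathbb{L}^n)) = n - 1.$$ -/

import Mathlib

/-- The real vector space of symmetric `n × n` real matrices. -/
def SymMat (n : ℕ) : Submodule ℝ (Matrix (Fin n) (Fin n) ℝ) where
  carrier := {A | A.IsSymm}
  add_mem' hA hB := Matrix.IsSymm.add hA hB
  zero_mem' := Matrix.isSymm_zero
  smul_mem' c _ hA := Matrix.IsSymm.smul hA c

/-- The symmetric matrix `a aᵀ`. -/
def outerSq {n : ℕ} (a : Fin n → ℝ) : SymMat n :=
  ⟨Matrix.vecMulVec a a, by
    change (Matrix.vecMulVec a a).transpose = Matrix.vecMulVec a a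
    ext i j
    simp [Matrix.vecMulVec_apply, mul_comm]⟩

theorem outerSq_smul {n : ℕ} (c : ℝ) (a : Fin n → ℝ) :
    outerSq (c • a) = (c * c) • outerSq a := by
  apply Subtype.ext
  ext i j
  simp [outerSq, Matrix.vecMulVec_apply]
  ring

/-- The completely positive cone over a nonempty cone `K` in `ℝⁿ`: all finite sums
`∑ aᵢ aᵢᵀ` with at least one term and with every `aᵢ ∈ K`.
The two proofs make it a convex cone that contains the origin. -/
def completelyPositiveCone {n : ℕ} (K : Set (Fin n → ℝ)) (hne : K.Nonempty)
    (hK : ∀ x ∈ K, ∀ c : ℝ, 0 ≤ c → c • x ∈ K) : PointedCone ℝ (SymMat n) where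
  carrier := {A | ∃ k : ℕ, 0 < k ∧ ∃ a : Fin k → (Fin n → ℝ),
    (∀ i, a i ∈ K) ∧ A = ∑ i, outerSq (a i)}
  zero_mem' := by
    obtain ⟨x, hx⟩ := hne
    refine ⟨1, one_pos, fun _ => (0 : ℝ) • x, fun _ => hK x hx 0 le_rfl, ?_⟩
    simp only [outerSq_smul]
    simp
  add_mem' := by
    rintro A B ⟨k, hk, a, ha, rfl⟩ ⟨l, _, b, hb, rfl⟩
    refine ⟨k + l, by omega, Fin.append a b, ?_, ?_⟩
    · intro i
      refine Fin.addCases (fun i => ?_) (fun i => ?_) i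
      · simpa using ha i
      · simpa using hb i
    · simp [Fin.sum_univ_add]
  smul_mem' := by
    rintro ⟨c, hc⟩ A ⟨k, hk, a, ha, rfl⟩
    refine ⟨k, hk, fun i => Real.sqrt c • a i,
      fun i => hK _ (ha i) _ (Real.sqrt_nonneg c), ?_⟩
    change c • (∑ i, outerSq (a i)) = _
    simp only [outerSq_smul, Real.mul_self_sqrt hc, Finset.smul_sum]

/-- The second-order cone `{x ∈ ℝⁿ | x₁ ≥ √(x₂² + ⋯ + xₙ²)}`; the first coordinate is `x 0`. -/
def secondOrderCone (n : ℕ) [NeZero n] : Set (Fin n → ℝ) :=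
  {x | Real.sqrt (∑ i ∈ Finset.univ.erase (0 : Fin n), x i ^ 2) ≤ x 0}

theorem secondOrderCone_nonempty (n : ℕ) [NeZero n] : (secondOrderCone n).Nonempty :=
  ⟨0, by simp [secondOrderCone]⟩

theorem secondOrderCone_smul_mem (n : ℕ) [NeZero n] :
    ∀ x ∈ secondOrderCone n, ∀ c : ℝ, 0 ≤ c → c • x ∈ secondOrderCone n := by
  intro x hx c hc
  have h : ∑ i ∈ Finset.univ.erase (0 : Fin n), (c • x) i ^ 2
      = c ^ 2 * ∑ i ∈ Finset.univ.erase (0 : Fin n), x i ^ 2 := by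
    rw [Finset.mul_sum]
    exact Finset.sum_congr rfl fun i _ => by simp [mul_pow]
  change Real.sqrt _ ≤ c * x 0
  rw [h, Real.sqrt_mul (sq_nonneg c), Real.sqrt_sq hc]
  exact mul_le_mul_of_nonneg_left hx hc

/-- The completely positive cone over the second-order cone. -/
def cpSecondOrder (n : ℕ) [NeZero n] : PointedCone ℝ (SymMat n) :=
  completelyPositiveCone (secondOrderCone n) (secondOrderCone_nonempty n)
    (secondOrderCone_smul_mem n)

/-- A convex cone is polyhedral if it is the intersection of finitely many closed half-spaces
`{x | 0 ≤ f x}`, with `f` a linear functional. -/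
def IsPolyhedralCone {V : Type*} [AddCommGroup V] [Module ℝ V] (C : PointedCone ℝ V) : Prop :=
  ∃ s : Finset (Module.Dual ℝ V), ∀ x : V, x ∈ C ↔ ∀ f ∈ s, 0 ≤ f x

/-- The set of the lengths `l` of the chains `F_l ⊂ ⋯ ⊂ F_1` of faces of `K` (`l ≥ 1`, all
inclusions strict) whose smallest face `F_l` is not polyhedral. An `LTSeries` is listed in
increasing order, so `F_l` is its head; its `length` counts the strict inclusions, so it
consists of `length + 1` faces. -/
def nonpolyhedralChainLengths {V : Type*} [AddCommGroup V] [Module ℝ V]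
    (K : PointedCone ℝ V) : Set ℕ :=
  {l | ∃ F : LTSeries (PointedCone ℝ V),
    (∀ i, (F i).IsFaceOf K) ∧ ¬ IsPolyhedralCone F.head ∧ l = F.length + 1}

/-- `l` is the distance to polyhedrality of `K`: the maximum length (number of faces) of a chain
of faces of `K` whose smallest face is not polyhedral. -/
def IsDistanceToPolyhedrality {V : Type*} [AddCommGroup V] [Module ℝ V]
    (K : PointedCone ℝ V) (l : ℕ) : Prop :=
  IsGreatest (nonpolyhedralChainLengths K) l

/-! By an S-lemma argument, the cone consists exactly of the positive semidefinite `X` with `0 ≤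
lorentzForm n X` (`mem_cpSecondOrder_of_mem_psdCone`). Hence a face is determined by the span of its
vectors and by whether the form is positive somewhere on it (`face_le_of_span_le`), so `faceRank`
increases strictly along chains of faces, with values at most `n + 1`. A face of rank at most 2 is
polyhedral, because its vectors lie on at most two rays. The faces of a chain with nonpolyhedral
head thus have distinct ranks in `3, …, n + 1`, so there are at most `n - 1` of them. The faces
`coordFace n k`, `2 ≤ k ≤ n`, attain this bound; the smallest has a curved boundary. -/

/-- The linear form `X ↦ 2 X₀₀ - tr X`, whose value at `a aᵀ` is the Lorentz form of `a`. -/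
def lorentzForm (n : ℕ) [NeZero n] : SymMat n →ₗ[ℝ] ℝ where
  toFun X := 2 * X.1 0 0 - X.1.trace
  map_add' X Y := by
    simp [Matrix.trace_add]
    ring
  map_smul' c X := by
    simp [Matrix.trace_smul]
    ring

/-- The linear form `X ↦ wᵀ X w`. -/
def quadEval {n : ℕ} (w : Fin n → ℝ) : SymMat n →ₗ[ℝ] ℝ where
  toFun X := ∑ i, ∑ j, w i * X.1 i j * w j
  map_add' X Y := by
    simp [mul_add, add_mul, Finset.sum_add_distrib]
  map_smul' c X := by
    simp only [Finset.mul_sum, RingHom.id_apply, smul_eq_mul]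
    refine Finset.sum_congr rfl fun i _ => Finset.sum_congr rfl fun j _ => ?_
    change w i * (c * X.1 i j) * w j = _
    ring

theorem quadEval_outerSq {n : ℕ} (w a : Fin n → ℝ) :
    quadEval w (outerSq a) = (∑ i, w i * a i) ^ 2 := by
  rw [sq, Finset.sum_mul_sum]
  change ∑ i, ∑ j, w i * (a i * a j) * w j = _
  refine Finset.sum_congr rfl fun i _ => Finset.sum_congr rfl fun j _ => ?_
  ring

theorem lorentzForm_outerSq {n : ℕ} [NeZero n] (a : Fin n → ℝ) :
    lorentzForm n (outerSq a) = a 0 ^ 2 - ∑ i ∈ Finset.univ.erase (0 : Fin n), a i ^ 2 := by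
  have h := Finset.add_sum_erase Finset.univ (fun i => a i ^ 2) (Finset.mem_univ (0 : Fin n))
  change 2 * (a 0 * a 0) - ∑ i, a i * a i = _
  simp only [← sq]
  rw [← h]
  ring

theorem outerSq_apply {n : ℕ} (a : Fin n → ℝ) (i j : Fin n) : (outerSq a).1 i j = a i * a j := rfl

theorem outerSq_neg {n : ℕ} (a : Fin n → ℝ) : outerSq (-a) = outerSq a := by
  simpa using outerSq_smul (-1) a

theorem outerSq_zero {n : ℕ} : outerSq (0 : Fin n → ℝ) = 0 := by
  simpa using outerSq_smul 0 (0 : Fin n → ℝ)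

theorem outerSq_add_add_outerSq_sub {n : ℕ} (a b : Fin n → ℝ) :
    outerSq (a + b) + outerSq (a - b) = (2 : ℝ) • outerSq a + (2 : ℝ) • outerSq b := by
  apply Subtype.ext
  ext i j
  change (a i + b i) * (a j + b j) + (a i - b i) * (a j - b j)
    = 2 * (a i * a j) + 2 * (b i * b j)
  ring

theorem mem_secondOrderCone_iff {n : ℕ} [NeZero n] {a : Fin n → ℝ} :
    a ∈ secondOrderCone n ↔ 0 ≤ a 0 ∧ 0 ≤ lorentzForm n (outerSq a) := by
  rw [lorentzForm_outerSq, sub_nonneg]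
  exact Real.sqrt_le_iff

theorem outerSq_mem_cpSecondOrder_of_mem {n : ℕ} [NeZero n] {a : Fin n → ℝ}
    (ha : a ∈ secondOrderCone n) : outerSq a ∈ cpSecondOrder n :=
  ⟨1, one_pos, fun _ => a, fun _ => ha, by simp⟩

theorem outerSq_mem_cpSecondOrder {n : ℕ} [NeZero n] {a : Fin n → ℝ}
    (ha : 0 ≤ lorentzForm n (outerSq a)) : outerSq a ∈ cpSecondOrder n := by
  rcases le_total 0 (a 0) with h | h
  · exact outerSq_mem_cpSecondOrder_of_mem (mem_secondOrderCone_iff.2 ⟨h, ha⟩)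
  · rw [← outerSq_neg]
    refine outerSq_mem_cpSecondOrder_of_mem (mem_secondOrderCone_iff.2 ⟨?_, ?_⟩)
    · simpa using h
    · rwa [outerSq_neg]

/-! ### Description of the cone by positive semidefiniteness and the Lorentz form -/

/-- The cone of all sums of squares `a aᵀ`, that is, of all positive semidefinite matrices. -/
def psdCone (n : ℕ) : PointedCone ℝ (SymMat n) :=
  completelyPositiveCone Set.univ Set.univ_nonempty (fun _ _ _ _ => Set.mem_univ _)

theorem outerSq_mem_psdCone {n : ℕ} (a : Fin n → ℝ) : outerSq a ∈ psdCone n :=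
  ⟨1, one_pos, fun _ => a, fun _ => Set.mem_univ _, by simp⟩

theorem cpSecondOrder_le_psdCone (n : ℕ) [NeZero n] : cpSecondOrder n ≤ psdCone n := by
  rintro X ⟨k, hk, a, -, rfl⟩
  exact ⟨k, hk, a, fun _ => Set.mem_univ _, rfl⟩

theorem quadEval_nonneg_of_mem_psdCone {n : ℕ} (w : Fin n → ℝ) {X : SymMat n}
    (hX : X ∈ psdCone n) : 0 ≤ quadEval w X := by
  obtain ⟨k, -, a, -, rfl⟩ := hX
  rw [map_sum]
  exact Finset.sum_nonneg fun i _ => by rw [quadEval_outerSq]; positivity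

theorem lorentzForm_nonneg_of_mem {n : ℕ} [NeZero n] {X : SymMat n}
    (hX : X ∈ cpSecondOrder n) : 0 ≤ lorentzForm n X := by
  obtain ⟨k, -, a, ha, rfl⟩ := hX
  rw [map_sum]
  exact Finset.sum_nonneg fun i _ => (mem_secondOrderCone_iff.1 (ha i)).2

/-- A sum of two squares can be rewritten so that a linear form that takes values of opposite
sign on the two squares vanishes on one of the new ones. -/
theorem exists_outerSq_add_outerSq_eq {n : ℕ} (f : SymMat n →ₗ[ℝ] ℝ) {x y : Fin n → ℝ}
    (hx : f (outerSq x) < 0) (hy : 0 < f (outerSq y)) :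
    ∃ u v : Fin n → ℝ, outerSq u + outerSq v = outerSq x + outerSq y ∧ f (outerSq u) = 0 := by
  set b : ℝ := f (outerSq (x + y) - outerSq x - outerSq y) with hb
  have key : ∀ t : ℝ, f (outerSq (x + t • y))
      = f (outerSq y) * (t * t) + b * t + f (outerSq x) := by
    intro t
    have : outerSq (x + t • y) = (t * t) • outerSq y
        + t • (outerSq (x + y) - outerSq x - outerSq y) + outerSq x := by
      apply Subtype.ext
      ext i j
      change (x i + t * y i) * (x j + t * y j) = t * t * (y i * y j)
        + t * ((x i + y i) * (x j + y j) - x i * x j - y i * y j) + x i * x j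
      ring
    rw [this, map_add, map_add, map_smul, map_smul, ← hb]
    simp only [smul_eq_mul]
    ring
  -- The outer coefficients have opposite signs, so the discriminant is positive.
  obtain ⟨t, ht⟩ : ∃ t : ℝ, f (outerSq y) * (t * t) + b * t + f (outerSq x) = 0 := by
    refine exists_quadratic_eq_zero hy.ne' ⟨Real.sqrt (discrim (f (outerSq y)) b (f (outerSq x))), ?_⟩
    rw [Real.mul_self_sqrt]
    unfold discrim
    nlinarith [sq_nonneg b, mul_pos hy (neg_pos.2 hx)]
  have hpos : (0 : ℝ) < 1 + t ^ 2 := by positivity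
  set c : ℝ := Real.sqrt (1 + t ^ 2)⁻¹ with hc
  have hcc : c * c = (1 + t ^ 2)⁻¹ := Real.mul_self_sqrt (by positivity)
  -- A rotation of the pair `(x, y)`, normalized by `c`, preserves the sum of the two squares.
  refine ⟨c • (x + t • y), c • (y - t • x), ?_, ?_⟩
  · rw [outerSq_smul, outerSq_smul, hcc, ← smul_add, inv_smul_eq_iff₀ hpos.ne']
    apply Subtype.ext
    ext i j
    change (x i + t * y i) * (x j + t * y j) + (y i - t * x i) * (y j - t * x j)
      = (1 + t ^ 2) * (x i * x j + y i * y j)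
    ring
  · rw [outerSq_smul, map_smul, key, ht, smul_zero]

/-- A square with negative form is paired with one of positive form, and the pair is rotated until
one new square is null. Splitting off the null square leaves the total form unchanged and one square
fewer. -/
theorem sum_map_outerSq_mem_cpSecondOrder {n : ℕ} [NeZero n] (k : ℕ) :
    ∀ s : Multiset (Fin n → ℝ), s.card = k → 0 ≤ lorentzForm n (s.map outerSq).sum →
      (s.map outerSq).sum ∈ cpSecondOrder n := by
  induction k with
  | zero =>
    intro s hs _
    rw [Multiset.card_eq_zero.1 hs]
    simp
  | succ k ih =>
    intro s hs h
    by_cases hall : ∀ a ∈ s, 0 ≤ lorentzForm n (outerSq a)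
    · refine multiset_sum_mem _ fun X hX => ?_
      obtain ⟨a, ha, rfl⟩ := Multiset.mem_map.1 hX
      exact outerSq_mem_cpSecondOrder (hall a ha)
    push Not at hall
    obtain ⟨x, hxs, hx⟩ := hall
    obtain ⟨t, rfl⟩ := Multiset.exists_cons_of_mem hxs
    rw [Multiset.map_cons, Multiset.sum_cons, map_add] at h
    obtain ⟨y, hyt, hy⟩ : ∃ y ∈ t, 0 < lorentzForm n (outerSq y) := by
      by_contra! hcon
      have : lorentzForm n (t.map outerSq).sum ≤ 0 := by
        rw [map_multiset_sum, Multiset.map_map]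
        refine Multiset.sum_induction (· ≤ 0) _ (fun _ _ => add_nonpos) le_rfl fun r hr => ?_
        obtain ⟨a, ha, rfl⟩ := Multiset.mem_map.1 hr
        exact hcon a ha
      linarith
    obtain ⟨r, rfl⟩ := Multiset.exists_cons_of_mem hyt
    obtain ⟨u, v, huv, hu⟩ := exists_outerSq_add_outerSq_eq (lorentzForm n) hx hy
    have hsum : ((x ::ₘ y ::ₘ r).map outerSq).sum
        = outerSq u + ((v ::ₘ r).map outerSq).sum := by
      simp only [Multiset.map_cons, Multiset.sum_cons]
      rw [← add_assoc, ← huv, add_assoc]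
    rw [hsum]
    refine add_mem (outerSq_mem_cpSecondOrder hu.ge) (ih _ ?_ ?_)
    · simpa using hs
    · rw [← map_add, ← Multiset.sum_cons, ← Multiset.map_cons, hsum, map_add, hu, zero_add] at h
      exact h

theorem mem_cpSecondOrder_of_mem_psdCone {n : ℕ} [NeZero n] {X : SymMat n}
    (hX : X ∈ psdCone n) (h : 0 ≤ lorentzForm n X) : X ∈ cpSecondOrder n := by
  obtain ⟨k, -, a, -, rfl⟩ := hX
  have hs : (((Finset.univ : Finset (Fin k)).val.map a).map outerSq).sum
      = ∑ i, outerSq (a i) := by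
    rw [Multiset.map_map]
    rfl
  rw [← hs] at h ⊢
  exact sum_map_outerSq_mem_cpSecondOrder _ _ rfl h

/-! ### Faces and their rank -/

/-- The vectors of the second-order cone whose squares lie in `F`. -/
def faceVectors {n : ℕ} [NeZero n] (F : PointedCone ℝ (SymMat n)) : Set (Fin n → ℝ) :=
  {a | a ∈ secondOrderCone n ∧ outerSq a ∈ F}

theorem exists_sum_outerSq_of_mem_face {n : ℕ} [NeZero n] {F : PointedCone ℝ (SymMat n)}
    (hF : F.IsFaceOf (cpSecondOrder n)) {X : SymMat n} (hX : X ∈ F) :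
    ∃ (k : ℕ) (a : Fin k → Fin n → ℝ), (∀ i, a i ∈ faceVectors F) ∧ X = ∑ i, outerSq (a i) := by
  obtain ⟨k, -, a, ha, rfl⟩ := hF.le hX
  exact ⟨k, a, fun i => ⟨ha i, hF.mem_of_sum_mem
    (fun i => outerSq_mem_cpSecondOrder_of_mem (ha i)) hX i⟩, rfl⟩

/-- Domination passes to sums by the parallelogram identity, since `outerSq (x - y)` is positive
semidefinite. -/
theorem exists_sub_outerSq_mem_psdCone {n : ℕ} [NeZero n] {F : PointedCone ℝ (SymMat n)}
    {b : Fin n → ℝ} (hb : b ∈ Submodule.span ℝ (faceVectors F)) :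
    ∃ X ∈ F, X - outerSq b ∈ psdCone n := by
  induction hb using Submodule.span_induction with
  | mem x hx => exact ⟨outerSq x, hx.2, by simp⟩
  | zero => exact ⟨0, zero_mem _, by simp [outerSq_zero]⟩
  | add x y _ _ hx hy =>
    obtain ⟨X, hX, hX'⟩ := hx
    obtain ⟨Y, hY, hY'⟩ := hy
    have h2 : (0 : ℝ) ≤ 2 := by norm_num
    refine ⟨(2 : ℝ) • X + (2 : ℝ) • Y, add_mem (F.smul_mem h2 hX) (F.smul_mem h2 hY), ?_⟩
    have : (2 : ℝ) • X + (2 : ℝ) • Y - outerSq (x + y)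
        = (2 : ℝ) • (X - outerSq x) + (2 : ℝ) • (Y - outerSq y) + outerSq (x - y) := by
      rw [eq_sub_of_add_eq (outerSq_add_add_outerSq_sub x y), smul_sub, smul_sub]
      abel
    rw [this]
    exact add_mem (add_mem ((psdCone n).smul_mem h2 hX') ((psdCone n).smul_mem h2 hY'))
      (outerSq_mem_psdCone _)
  | smul c x _ hx =>
    obtain ⟨X, hX, hX'⟩ := hx
    refine ⟨(c * c) • X, F.smul_mem (mul_self_nonneg c) hX, ?_⟩
    have h : (c * c) • (X - outerSq x) ∈ psdCone n :=
      (psdCone n).smul_mem (mul_self_nonneg c) hX'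
    rwa [outerSq_smul, ← smul_sub (c * c) X (outerSq x)]

/-- A face is determined by the span of its vectors and by whether it lies in the kernel of the
Lorentz form. -/
theorem face_le_of_span_le {n : ℕ} [NeZero n] {F G : PointedCone ℝ (SymMat n)}
    (hF : F.IsFaceOf (cpSecondOrder n)) (hG : G.IsFaceOf (cpSecondOrder n))
    (hspan : Submodule.span ℝ (faceVectors G) ≤ Submodule.span ℝ (faceVectors F))
    (hpos : (∃ X ∈ G, 0 < lorentzForm n X) → ∃ X ∈ F, 0 < lorentzForm n X) : G ≤ F := by
  intro X hX
  obtain ⟨k, a, ha, rfl⟩ := exists_sum_outerSq_of_mem_face hG hX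
  refine sum_mem fun i _ => ?_
  obtain ⟨Z, hZ, hZ'⟩ := exists_sub_outerSq_mem_psdCone (hspan (Submodule.subset_span (ha i)))
  suffices ∃ Y ∈ F, Y - outerSq (a i) ∈ cpSecondOrder n by
    obtain ⟨Y, hY, hY'⟩ := this
    refine hF.mem_of_add_mem_right hY' (outerSq_mem_cpSecondOrder_of_mem (ha i).1) ?_
    simpa using hY
  by_cases h : ∃ X ∈ F, 0 < lorentzForm n X
  · obtain ⟨Y, hY, hYpos⟩ := h
    -- Adding this multiple of `Y` compensates a possibly negative form of `Z - outerSq (a i)`.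
    set t : ℝ := |lorentzForm n (Z - outerSq (a i))| / lorentzForm n Y with ht
    have ht0 : 0 ≤ t := by positivity
    refine ⟨Z + t • Y, add_mem hZ (F.smul_mem ht0 hY), ?_⟩
    rw [add_sub_right_comm]
    refine mem_cpSecondOrder_of_mem_psdCone (add_mem hZ' ((psdCone n).smul_mem ht0
      (cpSecondOrder_le_psdCone n (hF.le hY)))) ?_
    rw [map_add, map_smul, smul_eq_mul, ht, div_mul_cancel₀ _ hYpos.ne']
    linarith [neg_abs_le (lorentzForm n (Z - outerSq (a i)))]
  · refine ⟨Z, hZ, mem_cpSecondOrder_of_mem_psdCone hZ' ?_⟩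
    have h1 : ¬ 0 < lorentzForm n (outerSq (a i)) := fun h1 => h (hpos ⟨_, (ha i).2, h1⟩)
    have h2 := lorentzForm_nonneg_of_mem (hF.le hZ)
    rw [map_sub]
    linarith

open Classical in
/-- The dimension of the span of the vectors of `F`, increased by one if the Lorentz form is
positive somewhere on `F`. -/
noncomputable def faceRank {n : ℕ} [NeZero n] (F : PointedCone ℝ (SymMat n)) : ℕ :=
  Module.finrank ℝ (Submodule.span ℝ (faceVectors F))
    + if ∃ X ∈ F, 0 < lorentzForm n X then 1 else 0

theorem faceRank_lt_faceRank {n : ℕ} [NeZero n] {F G : PointedCone ℝ (SymMat n)}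
    (hF : F.IsFaceOf (cpSecondOrder n)) (hG : G.IsFaceOf (cpSecondOrder n)) (hFG : F < G) :
    faceRank F < faceRank G := by
  have hspan : Submodule.span ℝ (faceVectors F) ≤ Submodule.span ℝ (faceVectors G) :=
    Submodule.span_mono fun a ha => ⟨ha.1, hFG.le ha.2⟩
  have hrank := Submodule.finrank_mono hspan
  have hpos : (∃ X ∈ F, 0 < lorentzForm n X) → ∃ X ∈ G, 0 < lorentzForm n X :=
    fun ⟨X, hX, h⟩ => ⟨X, hFG.le hX, h⟩
  by_contra hcon
  unfold faceRank at hcon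
  have key : Module.finrank ℝ (Submodule.span ℝ (faceVectors F))
      = Module.finrank ℝ (Submodule.span ℝ (faceVectors G)) ∧
      ((∃ X ∈ G, 0 < lorentzForm n X) → ∃ X ∈ F, 0 < lorentzForm n X) := by
    by_cases h1 : ∃ X ∈ F, 0 < lorentzForm n X
    · rw [if_pos h1, if_pos (hpos h1)] at hcon
      exact ⟨by omega, fun _ => h1⟩
    · by_cases h2 : ∃ X ∈ G, 0 < lorentzForm n X
      · rw [if_neg h1, if_pos h2] at hcon
        omega
      · rw [if_neg h1, if_neg h2] at hcon
        exact ⟨by omega, fun h => absurd h h2⟩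
  exact hFG.not_ge (face_le_of_span_le hF hG
    (Submodule.eq_of_le_of_finrank_eq hspan key.1).ge key.2)

theorem faceRank_le {n : ℕ} [NeZero n] (F : PointedCone ℝ (SymMat n)) : faceRank F ≤ n + 1 := by
  have h := Submodule.finrank_le (Submodule.span ℝ (faceVectors F))
  rw [Module.finrank_fin_fun] at h
  unfold faceRank
  split_ifs <;> omega

/-! ### Faces of rank at most two are polyhedral -/

/-- A cone generated by finitely many vectors that have a dual family is polyhedral. -/
theorem isPolyhedralCone_of_dual_family {V ι : Type*} [AddCommGroup V] [Module ℝ V]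
    [FiniteDimensional ℝ V] [Fintype ι] [DecidableEq ι] {C : PointedCone ℝ V} (v : ι → V)
    (φ : ι → Module.Dual ℝ V) (hφ : ∀ i j, φ i (v j) = if i = j then 1 else 0)
    (hC : ∀ x, x ∈ C ↔ ∃ c : ι → ℝ, (∀ i, 0 ≤ c i) ∧ x = ∑ i, c i • v i) :
    IsPolyhedralCone C := by
  classical
  let b := Module.finBasis ℝ V
  let P : V →ₗ[ℝ] V := LinearMap.id - ∑ i, (φ i).smulRight (v i)
  have hP : ∀ x, P x = x - ∑ i, φ i x • v i := fun x => by simp [P]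
  -- The coordinates of `P`, with both signs, force `P x = 0`, so that `x` lies in the span of the
  -- `v i`.
  refine ⟨Finset.univ.image φ ∪ (Finset.univ.image (fun k => b.coord k ∘ₗ P)
    ∪ Finset.univ.image (fun k => -(b.coord k ∘ₗ P))), fun x => ?_⟩
  rw [hC]
  constructor
  · rintro ⟨c, hc, rfl⟩
    have hcoef : ∀ i, φ i (∑ j, c j • v j) = c i := fun i => by simp [hφ]
    have hPx : P (∑ j, c j • v j) = 0 := by
      rw [hP]
      simp [hcoef]
    intro f hf
    simp only [Finset.mem_union, Finset.mem_image, Finset.mem_univ, true_and] at hf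
    rcases hf with ⟨i, rfl⟩ | ⟨k, rfl⟩ | ⟨k, rfl⟩
    · rw [hcoef]
      exact hc i
    · rw [LinearMap.comp_apply, hPx, map_zero]
    · rw [LinearMap.neg_apply, LinearMap.comp_apply, hPx, map_zero, neg_zero]
  · intro h
    refine ⟨fun i => φ i x, fun i => h _ (by simp), ?_⟩
    have hPx : P x = 0 := by
      refine b.ext_elem fun k => le_antisymm ?_ ?_
      · simpa using h (-(b.coord k ∘ₗ P)) (by simp)
      · simpa using h (b.coord k ∘ₗ P) (by simp)
    rwa [hP, sub_eq_zero] at hPx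

theorem exists_dual_vectors {n : ℕ} {ι : Type*} [DecidableEq ι] {f : ι → Fin n → ℝ}
    (hf : LinearIndependent ℝ f) :
    ∃ g : ι → Fin n → ℝ, ∀ i j, ∑ k, g i k * f j k = if i = j then 1 else 0 := by
  let B := Module.Basis.span hf
  choose φ hφ using fun i => LinearMap.exists_extend (B.coord i)
  refine ⟨fun i k => φ i (Pi.single k 1), fun i j => ?_⟩
  have h1 : φ i (f j) = if i = j then 1 else 0 := by
    have h : φ i (B j) = B.coord i (B j) := LinearMap.congr_fun (hφ i) (B j)
    rw [Module.Basis.coord_apply, Module.Basis.repr_self, Finsupp.single_apply] at h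
    have hB : (B j : Fin n → ℝ) = f j :=
      congrArg Subtype.val (Module.Basis.span_apply hf j)
    rw [← hB, h]
    simp [eq_comm]
  rw [← h1, LinearMap.pi_apply_eq_sum_univ (φ i) (f j)]
  refine Finset.sum_congr rfl fun k _ => ?_
  rw [smul_eq_mul, mul_comm]
  refine congrArg (f j k * φ i ·) (funext fun l => ?_)
  simp [Pi.single_apply, eq_comm]

/-- A face is polyhedral if its vectors are multiples of finitely many linearly independent
ones. -/
theorem isPolyhedralCone_of_forall_exists_smul {n : ℕ} [NeZero n] {F : PointedCone ℝ (SymMat n)}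
    (hF : F.IsFaceOf (cpSecondOrder n)) {ι : Type*} [Fintype ι] {f : ι → Fin n → ℝ}
    (hf : LinearIndependent ℝ f) (hfF : ∀ i, f i ∈ faceVectors F)
    (h : ∀ a ∈ faceVectors F, a ≠ 0 → ∃ i, ∃ c : ℝ, a = c • f i) : IsPolyhedralCone F := by
  classical
  obtain ⟨g, hg⟩ := exists_dual_vectors hf
  refine isPolyhedralCone_of_dual_family (fun i => outerSq (f i)) (fun i => quadEval (g i))
    (fun i j => ?_) fun X => ⟨fun hX => ?_, ?_⟩
  · rw [quadEval_outerSq, hg]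
    split_ifs <;> simp
  · obtain ⟨k, a, ha, rfl⟩ := exists_sum_outerSq_of_mem_face hF hX
    have hterm : ∀ l, ∃ c : ι → ℝ, (∀ i, 0 ≤ c i) ∧ outerSq (a l) = ∑ i, c i • outerSq (f i) := by
      intro l
      by_cases h0 : a l = 0
      · exact ⟨0, fun _ => le_rfl, by simp [h0, outerSq_zero]⟩
      · obtain ⟨i, c, hc⟩ := h _ (ha l) h0
        refine ⟨Pi.single i (c * c), fun j => ?_, ?_⟩
        · by_cases hj : j = i
          · subst hj
            simpa using mul_self_nonneg c
          · simp [hj]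
        · rw [Finset.sum_eq_single i (fun j _ hj => by simp [hj]) (by simp), hc, outerSq_smul]
          simp
    choose c hc hc' using hterm
    refine ⟨fun i => ∑ l, c l i, fun i => Finset.sum_nonneg fun l _ => hc l i, ?_⟩
    simp only [hc', Finset.sum_smul]
    exact Finset.sum_comm
  · rintro ⟨c, hc, rfl⟩
    exact sum_mem fun i _ => F.smul_mem (hc i) (hfF i).2

/-- Expansion of the Lorentz form of a linear combination of two vectors. -/
theorem lorentzForm_outerSq_add_smul {n : ℕ} [NeZero n] (a b : Fin n → ℝ) (s t : ℝ) :
    lorentzForm n (outerSq (s • a + t • b)) = s ^ 2 * lorentzForm n (outerSq a)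
      + t ^ 2 * lorentzForm n (outerSq b)
      + 2 * s * t * (a 0 * b 0 - ∑ i ∈ Finset.univ.erase (0 : Fin n), a i * b i) := by
  simp only [lorentzForm_outerSq, mul_sub, Finset.mul_sum, Pi.add_apply, Pi.smul_apply,
    smul_eq_mul]
  have : ∑ i ∈ Finset.univ.erase (0 : Fin n), (s * a i + t * b i) ^ 2
      = ∑ i ∈ Finset.univ.erase (0 : Fin n), s ^ 2 * a i ^ 2
        + ∑ i ∈ Finset.univ.erase (0 : Fin n), t ^ 2 * b i ^ 2
        + ∑ i ∈ Finset.univ.erase (0 : Fin n), 2 * s * t * (a i * b i) := by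
    rw [← Finset.sum_add_distrib, ← Finset.sum_add_distrib]
    exact Finset.sum_congr rfl fun i _ => by ring
  rw [this]
  ring

theorem eq_zero_of_lorentzForm_eq_zero {n : ℕ} [NeZero n] {a : Fin n → ℝ} (h0 : a 0 = 0)
    (ha : 0 ≤ lorentzForm n (outerSq a)) : a = 0 := by
  rw [lorentzForm_outerSq, h0] at ha
  have hsum : ∑ i ∈ Finset.univ.erase (0 : Fin n), a i ^ 2 = 0 :=
    le_antisymm (by linarith) (Finset.sum_nonneg fun i _ => sq_nonneg _)
  rw [Finset.sum_eq_zero_iff_of_nonneg fun i _ => sq_nonneg _] at hsum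
  ext i
  by_cases hi : i = 0
  · rw [hi, h0]
    rfl
  · simpa using hsum i (by simp [hi])

/-- A plane spanned by two null vectors has no other null directions. -/
theorem eq_zero_or_eq_zero_of_lorentzForm_eq_zero {n : ℕ} [NeZero n] {u v : Fin n → ℝ}
    (hu : lorentzForm n (outerSq u) = 0) (hv : lorentzForm n (outerSq v) = 0)
    (huv : LinearIndependent ℝ ![u, v]) {s t : ℝ}
    (h : lorentzForm n (outerSq (s • u + t • v)) = 0) : s = 0 ∨ t = 0 := by
  rw [LinearIndependent.pair_iff] at huv
  by_contra! hst
  rw [lorentzForm_outerSq_add_smul, hu, hv] at h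
  have hB : u 0 * v 0 - ∑ i ∈ Finset.univ.erase (0 : Fin n), u i * v i = 0 := by
    simpa [hst.1, hst.2] using h
  -- This combination has zero first coordinate, and it is null because `u` and `v` are null and
  -- Lorentz-orthogonal.
  have hw : v 0 • u + (-(u 0)) • v = 0 := by
    apply eq_zero_of_lorentzForm_eq_zero
    · simp [mul_comm]
    · rw [lorentzForm_outerSq_add_smul, hu, hv, hB]
      simp
  have h0 := huv _ _ hw
  have hu0 : u = 0 := eq_zero_of_lorentzForm_eq_zero (by simpa using h0.2) hu.ge
  exact one_ne_zero (huv 1 0 (by simp [hu0])).1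

theorem isPolyhedralCone_of_faceRank_le_two {n : ℕ} [NeZero n] {F : PointedCone ℝ (SymMat n)}
    (hF : F.IsFaceOf (cpSecondOrder n)) (h : faceRank F ≤ 2) : IsPolyhedralCone F := by
  obtain ⟨f, hfF, hspan, hf⟩ := Submodule.exists_fun_fin_finrank_span_eq ℝ (faceVectors F)
  refine isPolyhedralCone_of_forall_exists_smul hF hf hfF fun a ha ha0 => ?_
  have hmem : a ∈ Submodule.span ℝ (Set.range f) := by
    rw [hspan]
    exact Submodule.subset_span ha
  unfold faceRank at h
  generalize Module.finrank ℝ (Submodule.span ℝ (faceVectors F)) = d at f hfF hspan hf hmem h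
  obtain ⟨c, rfl⟩ := (Submodule.mem_span_range_iff_exists_fun ℝ).1 hmem
  have hd : d ≤ 2 := by omega
  interval_cases d
  · simp at ha0
  · exact ⟨0, c 0, by simp⟩
  -- Dimension 2 already uses up the rank, so the form vanishes on the face.
  · have hnull : ∀ b ∈ faceVectors F, lorentzForm n (outerSq b) = 0 := by
      intro b hb
      refine le_antisymm (not_lt.1 fun hpos => ?_) (mem_secondOrderCone_iff.1 hb.1).2
      rw [if_pos ⟨_, hb.2, hpos⟩] at h
      omega
    have hf2 : LinearIndependent ℝ ![f 0, f 1] := by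
      have : ![f 0, f 1] = f := by
        ext i
        fin_cases i <;> rfl
      rwa [this]
    have h0 := hnull _ ha
    rw [Fin.sum_univ_two] at h0 ⊢
    rcases eq_zero_or_eq_zero_of_lorentzForm_eq_zero (hnull _ (hfF 0)) (hnull _ (hfF 1)) hf2 h0 with hc | hc
    · exact ⟨1, c 1, by simp [hc]⟩
    · exact ⟨0, c 0, by simp [hc]⟩

/-! ### A chain of coordinate faces -/

/-- The matrices of the cone that are supported on the first `k` coordinates. -/
def coordFace (n : ℕ) [NeZero n] (k : ℕ) : PointedCone ℝ (SymMat n) where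
  carrier := {X | X ∈ cpSecondOrder n ∧ ∀ i : Fin n, k ≤ i → X.1 i i = 0}
  zero_mem' := ⟨zero_mem _, fun _ _ => rfl⟩
  add_mem' := by
    rintro X Y ⟨hX, hX'⟩ ⟨hY, hY'⟩
    refine ⟨add_mem hX hY, fun i hi => ?_⟩
    change X.1 i i + Y.1 i i = 0
    rw [hX' i hi, hY' i hi, add_zero]
  smul_mem' := by
    rintro c X ⟨hX, hX'⟩
    refine ⟨Submodule.smul_mem _ c hX, fun i hi => ?_⟩
    change (c : ℝ) * X.1 i i = 0
    rw [hX' i hi, mul_zero]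

theorem diag_nonneg_of_mem_cpSecondOrder {n : ℕ} [NeZero n] {X : SymMat n}
    (hX : X ∈ cpSecondOrder n) (i : Fin n) : 0 ≤ X.1 i i := by
  simpa [quadEval, Pi.single_apply] using
    quadEval_nonneg_of_mem_psdCone (Pi.single i 1) (cpSecondOrder_le_psdCone n hX)

theorem coordFace_isFaceOf (n : ℕ) [NeZero n] (k : ℕ) :
    (coordFace n k).IsFaceOf (cpSecondOrder n) := by
  refine ⟨fun X hX => hX.1, fun {X Y a} hX hY ha h => ⟨hX, fun i hi => ?_⟩⟩
  have h1 : a * X.1 i i + Y.1 i i = 0 := h.2 i hi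
  have h2 := diag_nonneg_of_mem_cpSecondOrder hX i
  have h3 := diag_nonneg_of_mem_cpSecondOrder hY i
  nlinarith [mul_nonneg ha.le h2]

theorem lorentzForm_outerSq_single_add {n : ℕ} [NeZero n] {m : Fin n} (hm : m ≠ 0) (t : ℝ) :
    lorentzForm n (outerSq (Pi.single 0 1 + t • Pi.single m 1)) = 1 - t ^ 2 := by
  rw [lorentzForm_outerSq, Finset.sum_eq_single m]
  · simp [hm]
  · intro i hi him
    simp [him, Finset.ne_of_mem_erase hi]
  · simp [hm]

theorem outerSq_single_add_mem_coordFace {n : ℕ} [NeZero n] {m : Fin n} (hm : m ≠ 0) {t : ℝ}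
    (ht : t ^ 2 ≤ 1) {k : ℕ} (hk : (m : ℕ) < k) :
    outerSq (Pi.single 0 1 + t • Pi.single m 1) ∈ coordFace n k := by
  refine ⟨outerSq_mem_cpSecondOrder ?_, fun i hi => ?_⟩
  · rw [lorentzForm_outerSq_single_add hm]
    linarith
  · have h1 : i ≠ m := by
      rintro rfl
      omega
    have h2 : i ≠ 0 := by
      rintro rfl
      simp at hi
      omega
    simp [outerSq_apply, h1, h2]

theorem coordFace_lt_coordFace {n : ℕ} [NeZero n] {k l : ℕ} (hk : 1 ≤ k) (hkl : k < l)
    (hkn : k < n) : coordFace n k < coordFace n l := by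
  refine lt_of_le_not_ge (fun X hX => ⟨hX.1, fun i hi => hX.2 i (by omega)⟩) fun hle => ?_
  have hm : (⟨k, hkn⟩ : Fin n) ≠ 0 := by
    intro h
    have := congrArg Fin.val h
    simp at this
    omega
  have h := (hle (outerSq_single_add_mem_coordFace hm (t := 1) (by norm_num) hkl)).2 ⟨k, hkn⟩ le_rfl
  simp [outerSq_apply, hm] at h

/-- The curve `p t` lies in the face but leaves it in the direction `-E`, so each of its points lies
on the zero set of a defining functional `f` with `0 < f E`. Along the curve such an `f` is a
genuine quadratic in `t`, so finitely many of them cannot cover an interval. -/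
theorem not_isPolyhedralCone_coordFace_two {n : ℕ} [NeZero n] (hn : 2 ≤ n) :
    ¬ IsPolyhedralCone (coordFace n 2) := by
  rintro ⟨s, hs⟩
  set m : Fin n := ⟨1, hn⟩ with hmdef
  have hm : m ≠ 0 := by
    intro h
    have := congrArg Fin.val h
    simp [hmdef] at this
  set p : ℝ → SymMat n := fun t => outerSq (Pi.single 0 1 + t • Pi.single m 1) with hp
  set E : SymMat n := outerSq (Pi.single m 1) with hE
  have hexp : ∀ t, p t = p 0 + (t / 2) • (p 1 - p (-1)) + t ^ 2 • E := by
    intro t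
    apply Subtype.ext
    ext i j
    set x : Fin n → ℝ := Pi.single 0 1
    set y : Fin n → ℝ := Pi.single m 1
    change (x i + t * y i) * (x j + t * y j) = (x i + 0 * y i) * (x j + 0 * y j)
      + t / 2 * ((x i + 1 * y i) * (x j + 1 * y j) - (x i + -1 * y i) * (x j + -1 * y j))
      + t ^ 2 * (y i * y j)
    ring
  have hmem : ∀ t ∈ Set.Ioo (0 : ℝ) 1, p t ∈ coordFace n 2 := fun t ht =>
    outerSq_single_add_mem_coordFace hm (by nlinarith [ht.1, ht.2]) (by simp [hmdef])
  have hnot : ∀ t, ∀ δ : ℝ, 0 < δ → p t - δ • E ∉ coordFace n 2 := by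
    intro t δ hδ hcon
    -- This vector is orthogonal to the one defining `p t`, but not to the one defining `E`.
    have h := quadEval_nonneg_of_mem_psdCone (t • Pi.single 0 1 - Pi.single m 1)
      (cpSecondOrder_le_psdCone n hcon.1)
    rw [map_sub, map_smul, quadEval_outerSq, quadEval_outerSq] at h
    simp [Pi.single_apply, mul_add, sub_mul, Finset.sum_add_distrib, hm, hm.symm] at h
    linarith
  have hex : ∀ t ∈ Set.Ioo (0 : ℝ) 1, ∃ f ∈ s, 0 < f E ∧ f (p t) = 0 := by
    intro t ht
    by_contra! hcon
    have hev : ∀ᶠ δ in nhdsWithin (0 : ℝ) (Set.Ioi 0), ∀ f ∈ s, 0 ≤ f (p t - δ • E) := by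
      rw [Finset.eventually_all]
      intro f hf
      have h0 := (hs _).1 (hmem t ht) f hf
      rcases le_or_gt (f E) 0 with hfE | hfE
      · filter_upwards [self_mem_nhdsWithin] with δ hδ
        rw [map_sub, map_smul, smul_eq_mul]
        nlinarith [mul_nonneg (le_of_lt hδ : (0 : ℝ) ≤ δ) (neg_nonneg.2 hfE)]
      · have hpos : 0 < f (p t) := lt_of_le_of_ne h0 (Ne.symm (hcon f hf hfE))
        filter_upwards [Ioo_mem_nhdsGT (div_pos hpos hfE)] with δ hδ
        rw [map_sub, map_smul, smul_eq_mul]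
        have := (lt_div_iff₀ hfE).1 hδ.2
        linarith
    obtain ⟨δ, hδ, hδ0⟩ := (hev.and self_mem_nhdsWithin).exists
    exact hnot t δ hδ0 ((hs _).2 hδ)
  have hfin : (⋃ f ∈ (s : Set (Module.Dual ℝ (SymMat n))), {t : ℝ | 0 < f E ∧ f (p t) = 0}).Finite := by
    refine s.finite_toSet.biUnion fun f _ => ?_
    by_cases hfE : 0 < f E
    · set q : Polynomial ℝ := Polynomial.C (f E) * Polynomial.X ^ 2
        + Polynomial.C (f (p 1 - p (-1)) / 2) * Polynomial.X + Polynomial.C (f (p 0)) with hq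
      have hq0 : q ≠ 0 := by
        intro h
        have := congrArg Polynomial.natDegree h
        rw [hq, Polynomial.natDegree_quadratic hfE.ne'] at this
        simp at this
      refine (q.roots.toFinset.finite_toSet).subset fun t ht => ?_
      have h := ht.2
      rw [hexp, map_add, map_add, map_smul, map_smul, smul_eq_mul, smul_eq_mul] at h
      rw [Finset.mem_coe, Multiset.mem_toFinset, Polynomial.mem_roots hq0, Polynomial.IsRoot.def]
      simp only [hq, Polynomial.eval_add, Polynomial.eval_mul, Polynomial.eval_C,
        Polynomial.eval_pow, Polynomial.eval_X]
      linarith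
    · exact Set.finite_empty.subset fun t ht => hfE ht.1
  refine (Set.Ioo_infinite (zero_lt_one' ℝ)) (hfin.subset fun t ht => ?_)
  obtain ⟨f, hf, h⟩ := hex t ht
  exact Set.mem_biUnion (Finset.mem_coe.2 hf) h

/-! ### Attainment and the upper bound -/

theorem mainTheorem8 (n : ℕ) [NeZero n] (hn : 2 ≤ n) :
    IsDistanceToPolyhedrality (cpSecondOrder n) (n - 1) := by
  constructor
  -- The `n - 2` strict inclusions join `n - 1` faces.
  · refine ⟨⟨n - 2, fun i => coordFace n (i + 2), fun i => ?_⟩, fun i => coordFace_isFaceOf n _,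
      not_isPolyhedralCone_coordFace_two hn, ?_⟩
    · have := i.2
      exact coordFace_lt_coordFace (by simp) (by simp) (by simp; omega)
    · change n - 1 = n - 2 + 1
      omega
  · rintro l ⟨F, hF, hpoly, rfl⟩
    have hmono : StrictMono fun i => faceRank (F i) := fun i j hij =>
      faceRank_lt_faceRank (hF i) (hF j) (F.strictMono hij)
    have hgrow : ∀ i : ℕ, ∀ hi : i < F.length + 1, faceRank F.head + i ≤ faceRank (F ⟨i, hi⟩) := by
      intro i
      induction i with
      | zero => exact fun _ => le_rfl
      | succ i ih =>
        intro hi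
        have h1 := ih (by omega)
        have h2 : faceRank (F ⟨i, by omega⟩) < faceRank (F ⟨i + 1, hi⟩) :=
          hmono (Fin.mk_lt_mk.2 (Nat.lt_succ_self i))
        omega
    have hhead : 2 < faceRank F.head :=
      not_le.1 fun h => hpoly (isPolyhedralCone_of_faceRank_le_two (hF 0) h)
    have h1 := hgrow F.length (Nat.lt_succ_self _)
    have h2 := faceRank_le (F ⟨F.length, Nat.lt_succ_self _⟩)
    omega
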